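/- Let $X$ be an instance space (a measurable space). There are $k\ge 1$ players; player $i$ can draw independent labelled examples from an unknown probability distribution $D_i$ over $X\times\{0,1\}$ (for instance, instances with an arbitrary distribution on $X$, labelled by an arbitrary unknown measurable target function). Let $D=\frac1k\sum_{i=1}^k D_i$, let $\mathrm{err}_D(h)=\Pr_{(x,y)\sim D}[h(x)\neq y]$ and, for a finite nonempty class $\mathcal H$ of measurable functions $X\to\{0,1\}$, let $\mathrm{opt}(\mathcal H)=\min_{h\in\mathcal H}\mathrm{err}_D(h)$. The players communicate by broadcast: in each step one player, determined by the messages so far, sends a bit or one of the labelled examples it has drawn (whether a bit or an example is sent is also determined by the messages so far); its message depends on its own sample, its own private random bits and the earlier messages (and on the shared randomness, if there is any). Each bit and each example sent is counted once. Each player's sample is finite, of a size fixed by the protocol. Below, $\log t$ stands for $\max\{1,\log_2 t\}$. Theorem. There is a universal constant $c>0$, and for each $\delta\in(0,1)$ a constant $C=C(\delta)>0$, such that for every $X$, every finite nonempty class $\mathcal H$ of measurable functions $X\to\{0,1\}$, every $k\ge1$ and every $\varepsilon\in(0,1)$ the following hold. (1) There is a protocol without shared randomness that, for all $D_1,\dots,D_k$,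 with probability at least $1-\delta$ ends with a hypothesis $h$, known to all players, with $\mathrm{err}_D(h)\le c\cdot\mathrm{opt}(\mathcal H)+\varepsilon$, and whose total communication is always at most $C\,k\,\log|\mathcal H|\,\log\log|\mathcal H|\,\log(1/\varepsilon)$ examples and at most $C\,k\,\log|\mathcal H|\,\log\log|\mathcal H|\,\log^2(1/\varepsilon)$ additional bits. (2) If shared randomness is available, there is a protocol with the same guarantee on the error, whose total communication is always at most $C\,k\,\log|\mathcal H|\,\log\log|\mathcal H|\,\log(1/\varepsilon)$ examples, and which sends no bits. -/

import Mathlib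

open MeasureTheory

universe u

namespace DistLearning

/-- A labelled example: an instance together with its binary label. -/
abbrev LabelledExample (X : Type u) : Type u := X × Bool

/-- A deterministic broadcast protocol tree for `k` players over the instance space `X`.
Every player privately holds a sequence of `m` labelled examples (its own random sample) and a
private random seed in `Fin (q + 1)`.  At an inner node one designated player broadcasts one bit,
or one labelled example out of its own sample; the choice depends only on the node (that is, on
what has been broadcast so far), on the player's own sample and on its own seed.  Which player
speaks next, and whether it sends a bit or an example, is determined by what has been broadcast,
so nothing can be deduced from silence.  At a leaf the protocol ends with a hypothesis that is
determined by the broadcast messages, hence is known to all players (and to a listening center). -/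
inductive Tree (X : Type u) (k m q : ℕ) : Type u where
  | halt (h : X → Bool) : Tree X k m q
  | sendBit (i : Fin k) (msg : (Fin m → LabelledExample X) → Fin (q + 1) → Bool)
      (next : Bool → Tree X k m q) : Tree X k m q
  | sendExample (i : Fin k) (msg : (Fin m → LabelledExample X) → Fin (q + 1) → Fin m)
      (next : LabelledExample X → Tree X k m q) : Tree X k m q

namespace Tree

variable {X : Type u} {k m q : ℕ}

/-- The hypothesis reached when the players hold the samples `S` and the private seeds `r`. -/
def hypothesis (S : Fin k → Fin m → LabelledExample X) (r : Fin k → Fin (q + 1)) :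
    Tree X k m q → (X → Bool)
  | halt h => h
  | sendBit i msg next => hypothesis S r (next (msg (S i) (r i)))
  | sendExample i msg next => hypothesis S r (next (S i (msg (S i) (r i))))

/-- The number of bits broadcast in the run on `S` and `r`. -/
def bits (S : Fin k → Fin m → LabelledExample X) (r : Fin k → Fin (q + 1)) :
    Tree X k m q → ℕ
  | halt _ => 0
  | sendBit i msg next => bits S r (next (msg (S i) (r i))) + 1
  | sendExample i msg next => bits S r (next (S i (msg (S i) (r i))))

/-- The number of examples broadcast in the run on `S` and `r`. -/
def examples (S : Fin k → Fin m → LabelledExample X) (r : Fin k → Fin (q + 1)) :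
    Tree X k m q → ℕ
  | halt _ => 0
  | sendBit i msg next => examples S r (next (msg (S i) (r i)))
  | sendExample i msg next => examples S r (next (S i (msg (S i) (r i)))) + 1

end Tree

/-- A randomized distributed learning protocol for `k` players: a sample size `m` per player, the
size `q + 1` of the range of the players' private seeds, the size `p + 1` of the range of the
shared random seed, and for each value of the shared seed a protocol tree. -/
structure Protocol (X : Type u) (k : ℕ) where
  m : ℕ
  q : ℕ
  p : ℕ
  tree : Fin (p + 1) → Tree X k m q

namespace Protocol

variable {X : Type u} {k : ℕ}

/-- The shared seed takes only one value, so all randomness is private. -/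
def NoSharedRandomness (π : Protocol X k) : Prop := π.p = 0

/-- The seeds: one shared seed, and one private seed per player. -/
abbrev Seeds (π : Protocol X k) : Type := Fin (π.p + 1) × (Fin k → Fin (π.q + 1))

/-- The samples of all the players. -/
abbrev Samples (π : Protocol X k) : Type u := Fin k → Fin π.m → LabelledExample X

/-- The hypothesis on which a run of the protocol ends. -/
def output (π : Protocol X k) (ω : π.Seeds × π.Samples) : X → Bool :=
  (π.tree ω.1.1).hypothesis ω.2 ω.1.2

/-- The number of bits broadcast in a run of the protocol. -/
def bitCost (π : Protocol X k) (ω : π.Seeds × π.Samples) : ℕ :=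
  (π.tree ω.1.1).bits ω.2 ω.1.2

/-- The number of examples broadcast in a run of the protocol. -/
def exampleCost (π : Protocol X k) (ω : π.Seeds × π.Samples) : ℕ :=
  (π.tree ω.1.1).examples ω.2 ω.1.2

/-- The law of a run when player `i` draws its examples from `D i`: the seeds are uniform and
independent, the `m` examples of player `i` are independent with law `D i`, and all these
are independent of each other. -/
noncomputable def law [MeasurableSpace X] (π : Protocol X k)
    (D : Fin k → Measure (LabelledExample X)) : Measure (π.Seeds × π.Samples) :=
  (PMF.uniformOfFintype π.Seeds).toMeasure.prod
    (Measure.pi fun i => Measure.pi fun _ => D i)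

end Protocol

variable {X : Type u} [MeasurableSpace X]

/-- The mixture `(1/k) ∑ D i` of the players' distributions. -/
noncomputable def mixture {k : ℕ} (D : Fin k → Measure (LabelledExample X)) :
    Measure (LabelledExample X) :=
  (k : ENNReal)⁻¹ • ∑ i, D i

/-- The error of the hypothesis `h` on the labelled distribution `D`. -/
noncomputable def err (D : Measure (LabelledExample X)) (h : X → Bool) : ℝ :=
  D.real {z | h z.1 ≠ z.2}

/-- The least error on `D` of a hypothesis in the finite class `H`. -/
noncomputable def opt (D : Measure (LabelledExample X)) (H : Finset (X → Bool)) : ℝ :=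
  ⨅ h : H, err D h

/-- Whatever the distributions `D 1, …, D k` over labelled examples are, with probability at least
`1 - δ` the protocol ends on a hypothesis whose error on the mixture is at most
`c * opt + ε`. -/
def AgnosticallyLearns {k : ℕ} (π : Protocol X k) (H : Finset (X → Bool)) (c ε δ : ℝ) : Prop :=
  (∀ ω, Measurable (π.output ω)) ∧
  ∀ D : Fin k → Measure (LabelledExample X), (∀ i, IsProbabilityMeasure (D i)) →
    π.law D {ω | ¬ err (mixture D) (π.output ω) ≤ c * opt (mixture D) H + ε}
      ≤ ENNReal.ofReal δ

/-- The logarithm as it is used in asymptotic bounds: to the base two, and at least one. -/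
noncomputable def lg (t : ℝ) : ℝ := max 1 (Real.logb 2 t)

end DistLearning

open DistLearning

/-! The protocol is multiplicative weights over the class, with the weighted majority vote as
current hypothesis. In each round every player sends a uniformly random example of its sample that
the vote misclassifies, together with the error rate of the vote on its sample in `b` binary digits.
Each digit is itself carried by an example, misclassified for `1` and correctly classified for `0`.
Hence no bits and no shared randomness are needed, and one protocol serves both claims.

On a misclassified example at least half of the weight is wrong, so averaging the players in
proportion to their error rates and halving the weight of wrong hypotheses takes the total weight to
at most 3/4 of itself (`sum_reweight_le`). Fix a hypothesis `h` and the samples. If the rounded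
error of the vote is at least 9 times that of `h`, the expected loss of `h` on the random examples
is at most 1/9 (`sum_loss_le`). The ratio of total weight to the weight of `h` then shrinks in
expectation by `3/4 * (1 + 1/9) = 5/6`. It starts at the size of the class and never falls below 1,
so all `n` rounds are bad with probability at most that size times `(5/6)^n` (`card_allBad_le`).
Otherwise some vote is within a factor 9 of `h`, up to rounding, and the vote with the least
announced error is as good (`roundsRun_mul_le`).

An instance matters only through its vector of labels under the class, so the instance space may be
taken finite. Chebyshev and a union bound over all classifiers then pass from samples to
distributions; the sample size does not enter the communication cost. -/

namespace DistLearning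

namespace Tree

/-! ### Protocols made of rounds of simultaneous examples. -/

section Blocks

variable {X : Type u} {k m q : ℕ} (S : Fin k → Fin m → LabelledExample X) (r : Fin k → Fin (q + 1))

/-- A block of `n` examples, whose senders and messages do not depend on one another. -/
def ask : (n : ℕ) → (Fin n → Fin k) →
    (Fin n → (Fin m → LabelledExample X) → Fin (q + 1) → Fin m) →
    ((Fin n → LabelledExample X) → Tree X k m q) → Tree X k m q
  | 0, _, _, next => next Fin.elim0
  | n + 1, p, f, next => sendExample (p 0) (f 0) fun z =>
      ask n (Fin.tail p) (Fin.tail f) fun zs => next (Fin.cons z zs)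

/-- What is broadcast in a block of examples. -/
abbrev answers {ι : Type*} (p : ι → Fin k)
    (f : ι → (Fin m → LabelledExample X) → Fin (q + 1) → Fin m) (a : ι) : LabelledExample X :=
  S (p a) (f a (S (p a)) (r (p a)))

lemma cons_answers {n : ℕ} (p : Fin (n + 1) → Fin k)
    (f : Fin (n + 1) → (Fin m → LabelledExample X) → Fin (q + 1) → Fin m) :
    (Fin.cons (answers S r p f 0) (answers S r (Fin.tail p) (Fin.tail f)) :
      Fin (n + 1) → LabelledExample X) = answers S r p f := by
  funext j
  exact Fin.cases rfl (fun _ => rfl) j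

lemma hypothesis_ask (n : ℕ) (p : Fin n → Fin k)
    (f : Fin n → (Fin m → LabelledExample X) → Fin (q + 1) → Fin m)
    (next : (Fin n → LabelledExample X) → Tree X k m q) :
    hypothesis S r (ask n p f next) = hypothesis S r (next (answers S r p f)) := by
  induction n with
  | zero => rw [ask, Subsingleton.elim Fin.elim0 (answers S r p f)]
  | succ n ih => rw [ask, hypothesis, ih, ← cons_answers]

lemma bits_ask (n : ℕ) (p : Fin n → Fin k)
    (f : Fin n → (Fin m → LabelledExample X) → Fin (q + 1) → Fin m)
    (next : (Fin n → LabelledExample X) → Tree X k m q) :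
    bits S r (ask n p f next) = bits S r (next (answers S r p f)) := by
  induction n with
  | zero => rw [ask, Subsingleton.elim Fin.elim0 (answers S r p f)]
  | succ n ih => rw [ask, bits, ih, ← cons_answers]

lemma examples_ask (n : ℕ) (p : Fin n → Fin k)
    (f : Fin n → (Fin m → LabelledExample X) → Fin (q + 1) → Fin m)
    (next : (Fin n → LabelledExample X) → Tree X k m q) :
    examples S r (ask n p f next) = examples S r (next (answers S r p f)) + n := by
  induction n with
  | zero => rw [ask, Subsingleton.elim Fin.elim0 (answers S r p f), add_zero]
  | succ n ih => rw [ask, examples, ih, ← cons_answers, add_assoc]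

/-- A block of examples indexed by a finite type. -/
noncomputable def askAll {ι : Type*} [Fintype ι] (p : ι → Fin k)
    (f : ι → (Fin m → LabelledExample X) → Fin (q + 1) → Fin m)
    (next : (ι → LabelledExample X) → Tree X k m q) : Tree X k m q :=
  ask (Fintype.card ι) (fun j => p ((Fintype.equivFin ι).symm j))
    (fun j => f ((Fintype.equivFin ι).symm j)) fun z => next fun a => z (Fintype.equivFin ι a)

section Play

variable {ι σ U : Type*} [Fintype ι] (p : ι → Fin k)
  (msg : σ → ι → (Fin m → LabelledExample X) → U → Fin m)
  (upd : σ → (ι → LabelledExample X) → σ) (out : σ → X → Bool)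

/-- A protocol that proceeds in `n` rounds: in each round a block of examples is broadcast, each of
which may depend on the current public state and on a fresh part of the seed of its sender, and the
public state is updated. -/
noncomputable def play : (n : ℕ) → (Fin (q + 1) → Fin n → U) → σ → Tree X k m q
  | 0, _, s => halt (out s)
  | n + 1, g, s => askAll p (fun a S r => msg s a S (g r 0)) fun z =>
      play n (fun r => Fin.tail (g r)) (upd s z)

/-- The public state after one round. -/
abbrev playStep (s : σ) (u : Fin k → U) : σ :=
  upd s fun a => S (p a) (msg s a (S (p a)) (u (p a)))

/-- The public state after `n` rounds. -/
def playRun : (n : ℕ) → (Fin n → Fin k → U) → σ → σ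
  | 0, _, s => s
  | n + 1, u, s => playRun n (Fin.tail u) (playStep S p msg upd s (u 0))

lemma hypothesis_play (n : ℕ) (g : Fin (q + 1) → Fin n → U) (s : σ) :
    hypothesis S r (play p msg upd out n g s) =
      out (playRun S p msg upd n (fun t i => g (r i) t) s) := by
  induction n generalizing s with
  | zero => rfl
  | succ n ih =>
    rw [play, askAll, hypothesis_ask, ih, playRun]
    simp only [answers, Equiv.symm_apply_apply]
    rfl

lemma bits_play (n : ℕ) (g : Fin (q + 1) → Fin n → U) (s : σ) :
    bits S r (play p msg upd out n g s) = 0 := by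
  induction n generalizing s with
  | zero => rfl
  | succ n ih => rw [play, askAll, bits_ask, ih]

lemma examples_play (n : ℕ) (g : Fin (q + 1) → Fin n → U) (s : σ) :
    examples S r (play p msg upd out n g s) = n * Fintype.card ι := by
  induction n generalizing s with
  | zero => simp [play, examples]
  | succ n ih => rw [play, askAll, examples_ask, ih, add_mul, one_mul]

end Play

end Blocks

/-! ### Pulling a protocol tree back along a map of instance spaces. -/

section Comap

variable {X Y : Type u} {k m q : ℕ} (φ : X → Y)

/-- The labelled example that a map of instance spaces makes of a labelled example. -/
def mapExample (z : LabelledExample X) : LabelledExample Y := (φ z.1, z.2)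

/-- Run a protocol for `Y` on the images of instances in `X`. -/
def comap : Tree Y k m q → Tree X k m q
  | halt h => halt (h ∘ φ)
  | sendBit i msg next =>
      sendBit i (fun S => msg (mapExample φ ∘ S)) fun b => comap (next b)
  | sendExample i msg next =>
      sendExample i (fun S => msg (mapExample φ ∘ S)) fun z => comap (next (mapExample φ z))

variable (S : Fin k → Fin m → LabelledExample X) (r : Fin k → Fin (q + 1)) (t : Tree Y k m q)

lemma hypothesis_comap :
    hypothesis S r (comap φ t) = hypothesis (fun i => mapExample φ ∘ S i) r t ∘ φ := by
  induction t with
  | halt h => rfl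
  | sendBit i msg next ih => simp only [comap, hypothesis, ih]
  | sendExample i msg next ih => simp only [comap, hypothesis, ih, Function.comp_apply]

lemma bits_comap : bits S r (comap φ t) = bits (fun i => mapExample φ ∘ S i) r t := by
  induction t with
  | halt h => rfl
  | sendBit i msg next ih => simp only [comap, bits, ih]
  | sendExample i msg next ih => simp only [comap, bits, ih, Function.comp_apply]

lemma examples_comap :
    examples S r (comap φ t) = examples (fun i => mapExample φ ∘ S i) r t := by
  induction t with
  | halt h => rfl
  | sendBit i msg next ih => simp only [comap, examples, ih]
  | sendExample i msg next ih => simp only [comap, examples, ih, Function.comp_apply]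

end Comap

end Tree

open Finset

/-! ### Uniform choice from a set of unknown size. -/

section Pick

variable {m : ℕ} [NeZero m]

/-- The element of `M` with index `a` modulo the size of `M`, if `M` is not empty. -/
noncomputable def pick (M : Finset (Fin m)) (a : ℕ) : Fin m :=
  if h : 0 < #M then M.equivFin.symm ⟨a % #M, Nat.mod_lt a h⟩ else 0

lemma pick_mem {M : Finset (Fin m)} (h : M.Nonempty) (a : ℕ) : pick M a ∈ M := by
  rw [pick, dif_pos h.card_pos]
  exact (M.equivFin.symm _).2

lemma sum_range_mul_mod {n : ℕ} (g : ℕ → ℝ) (d : ℕ) :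
    ∑ a ∈ range (d * n), g (a % n) = d * ∑ a ∈ range n, g a := by
  induction d with
  | zero => simp
  | succ d ih =>
    rw [add_mul, one_mul, sum_range_add, ih]
    push_cast
    rw [add_mul, one_mul]
    congr 1
    refine sum_congr rfl fun a ha => ?_
    rw [mul_comm d n, Nat.mul_add_mod, Nat.mod_eq_of_lt (mem_range.1 ha)]

/-- A random index below `m !` picks a uniformly distributed element. -/
lemma card_mul_sum_pick {M : Finset (Fin m)} (hM : M.Nonempty) (g : Fin m → ℝ) :
    #M * ∑ a : Fin m.factorial, g (pick M a) = m.factorial * ∑ j ∈ M, g j := by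
  have hle : #M ≤ m := by simpa using card_le_univ M
  -- Every possible size of `M` divides `m !`, so reduction modulo that size is exactly uniform.
  obtain ⟨d, hd⟩ := Nat.dvd_factorial hM.card_pos hle
  have hmod : ∀ a, pick M a = pick M (a % #M) := fun a => by
    rw [pick, pick]
    split_ifs <;> simp only [Nat.mod_mod]
  rw [Fin.sum_univ_eq_sum_range (fun a => g (pick M a)), hd, mul_comm (#M) d]
  rw [sum_congr rfl fun a _ => congrArg g (hmod a), sum_range_mul_mod (fun a => g (pick M a))]
  have : ∑ a ∈ range #M, g (pick M a) = ∑ j ∈ M, g j := by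
    rw [← Fin.sum_univ_eq_sum_range (fun a => g (pick M a)), ← sum_coe_sort M g]
    refine Fintype.sum_equiv M.equivFin.symm _ _ fun a => ?_
    rw [pick, dif_pos hM.card_pos]
    simp [Nat.mod_eq_of_lt a.2]
  rw [this]
  push_cast
  ring

end Pick

/-! ### Binary digits of error rates. -/

section Level

/-- The proportion `c / m` rounded down to `b` binary digits. -/
def level (b m c : ℕ) : ℕ := min (c * 2 ^ b / m) (2 ^ b - 1)

variable {b m c : ℕ}

lemma level_lt : level b m c < 2 ^ b :=
  (min_le_right _ _).trans_lt (Nat.sub_lt (by positivity) one_pos)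

lemma level_mul_le : level b m c * m ≤ c * 2 ^ b :=
  (Nat.mul_le_mul_right _ (min_le_left _ _)).trans (Nat.div_mul_le_self _ _)

lemma le_level_add_one_mul (hm : 0 < m) (hc : c ≤ m) : c * 2 ^ b ≤ (level b m c + 1) * m := by
  rcases le_total (c * 2 ^ b / m) (2 ^ b - 1) with h | h
  · rw [level, min_eq_left h, mul_comm _ m]
    exact (Nat.lt_mul_div_succ _ hm).le
  · rw [level, min_eq_right h, Nat.sub_add_cancel Nat.one_le_two_pow, mul_comm]
    exact Nat.mul_le_mul_left _ hc

/-- A digit `1` can be announced only if a misclassified example exists to announce it with. -/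
lemma pos_of_testBit_level {l : ℕ} (h : (level b m c).testBit l = true) : 0 < c := by
  rcases Nat.eq_zero_or_pos c with rfl | hc
  · simp [level] at h
  · exact hc

/-- A digit `0` needs a correctly classified example. The cap at `2 ^ b - 1` in `level` provides it:
if all examples are misclassified, every digit is `1`. -/
lemma lt_of_testBit_level {l : ℕ} (hm : 0 < m) (hl : l < b) (hc : c ≤ m)
    (h : (level b m c).testBit l = false) : c < m := by
  refine lt_of_le_of_ne hc ?_
  rintro rfl
  rw [level, Nat.mul_div_cancel_left _ hm, min_eq_right (Nat.sub_le _ _),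
    Nat.testBit_two_pow_sub_one] at h
  simp [hl] at h

end Level

/-! ### Multiplicative weights and the potential. -/

section Loss

variable {ι : Type*}

/-- The weight of the senders whose example is misclassified by the hypothesis `h`, as a fraction
of the weight of all senders. -/
noncomputable def loss {k : ℕ} (v : Fin k → ℕ) (z : Fin k → LabelledExample (ι → Bool)) (h : ι) :
    ℝ :=
  (∑ i, if (z i).1 h ≠ (z i).2 then (v i : ℝ) else 0) / ∑ i, (v i : ℝ)

lemma loss_nonneg {k : ℕ} (v : Fin k → ℕ) (z : Fin k → LabelledExample (ι → Bool)) (h : ι) :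
    0 ≤ loss v z h :=
  div_nonneg (sum_nonneg fun i _ => by positivity) (by positivity)

lemma loss_le_one {k : ℕ} (v : Fin k → ℕ) (z : Fin k → LabelledExample (ι → Bool)) (h : ι) :
    loss v z h ≤ 1 :=
  div_le_one_of_le₀ (sum_le_sum fun i _ => by split_ifs <;> simp) (by positivity)

/-- The multiplicative update of the weights. -/
noncomputable def reweight {k : ℕ} (w : ι → ℝ) (v : Fin k → ℕ)
    (z : Fin k → LabelledExample (ι → Bool)) (h : ι) : ℝ :=
  w h * (1 - loss v z h / 2)

lemma reweight_pos {k : ℕ} {w : ι → ℝ} (hw : ∀ h, 0 < w h) (v : Fin k → ℕ)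
    (z : Fin k → LabelledExample (ι → Bool)) (h : ι) : 0 < reweight w v z h :=
  mul_pos (hw h) (by linarith [loss_le_one v z h])

end Loss

section Vote

variable {ι : Type*} [Fintype ι]

/-- The weighted majority vote of the coordinates. -/
noncomputable def vote (w : ι → ℝ) (x : ι → Bool) : Bool :=
  decide (∑ h, w h ≤ 2 * ∑ h, if x h = true then w h else 0)

lemma sum_le_of_vote_ne (w : ι → ℝ) {z : LabelledExample (ι → Bool)} (hz : vote w z.1 ≠ z.2) :
    ∑ h, w h ≤ 2 * ∑ h, if z.1 h ≠ z.2 then w h else 0 := by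
  obtain ⟨x, y⟩ := z
  cases y with
  | false => simpa [vote] using hz
  | true =>
    have h1 : ∑ h, w h = (∑ h, if x h = true then w h else 0) +
        ∑ h, if x h ≠ true then w h else 0 := by
      rw [← sum_add_distrib]
      exact sum_congr rfl fun h _ => by by_cases hx : x h = true <;> simp [hx]
    have h2 : ¬ ∑ h, w h ≤ 2 * ∑ h, if x h = true then w h else 0 := by
      simpa [vote] using hz
    dsimp only
    linarith

/-- Exchanging the two sums, the weighted average of the losses is at least 1/2, since each sender
that counts shows an example on which at least half of the weight is wrong. The update removes half
of that. -/
lemma sum_reweight_le {k : ℕ} (w : ι → ℝ) {v : Fin k → ℕ}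
    {z : Fin k → LabelledExample (ι → Bool)} (hQ : 0 < ∑ i, v i)
    (hz : ∀ i, 0 < v i → vote w (z i).1 ≠ (z i).2) :
    ∑ h, reweight w v z h ≤ 3 / 4 * ∑ h, w h := by
  have hQ' : (0 : ℝ) < ∑ i, (v i : ℝ) := by exact_mod_cast hQ
  have key : (∑ i, (v i : ℝ)) * ∑ h, w h ≤
      2 * ∑ h, w h * ∑ i, if (z i).1 h ≠ (z i).2 then (v i : ℝ) else 0 := by
    have e : 2 * ∑ h, w h * ∑ i, (if (z i).1 h ≠ (z i).2 then (v i : ℝ) else 0) =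
        ∑ i, (v i : ℝ) * (2 * ∑ h, if (z i).1 h ≠ (z i).2 then w h else 0) := by
      simp_rw [mul_sum]
      rw [sum_comm]
      refine sum_congr rfl fun i _ => sum_congr rfl fun h _ => ?_
      split_ifs <;> ring
    rw [e, sum_mul]
    refine sum_le_sum fun i _ => ?_
    rcases Nat.eq_zero_or_pos (v i) with h0 | h0
    · simp [h0]
    · exact mul_le_mul_of_nonneg_left (sum_le_of_vote_ne w (hz i h0)) (Nat.cast_nonneg _)
  have e : ∑ h, reweight w v z h = ∑ h, w h -
      (∑ h, w h * ∑ i, if (z i).1 h ≠ (z i).2 then (v i : ℝ) else 0) / (∑ i, (v i : ℝ)) / 2 := by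
    rw [sum_div, sum_div, ← sum_sub_distrib]
    refine sum_congr rfl fun h _ => ?_
    rw [reweight, loss]
    ring
  have : (∑ h, w h) / 2 ≤
      (∑ h, w h * ∑ i, if (z i).1 h ≠ (z i).2 then (v i : ℝ) else 0) / (∑ i, (v i : ℝ)) := by
    rw [le_div_iff₀ hQ']
    linarith
  rw [e]
  linarith

/-- The total weight relative to the weight of the hypothesis `h`. -/
noncomputable def potential (h : ι) (w : ι → ℝ) : ℝ := (∑ g, w g) / w h

lemma one_le_potential {w : ι → ℝ} (hw : ∀ g, 0 < w g) (h : ι) : 1 ≤ potential h w := by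
  rw [potential, one_le_div (hw h)]
  exact single_le_sum (f := w) (fun g _ => (hw g).le) (mem_univ h)

lemma potential_reweight_le {k : ℕ} {w : ι → ℝ} (hw : ∀ g, 0 < w g) (h : ι) {v : Fin k → ℕ}
    {z : Fin k → LabelledExample (ι → Bool)} (hQ : 0 < ∑ i, v i)
    (hz : ∀ i, 0 < v i → vote w (z i).1 ≠ (z i).2) :
    potential h (reweight w v z) ≤ 3 / 4 * potential h w * (1 + loss v z h) := by
  have h0 := loss_nonneg v z h
  have h1 := loss_le_one v z h
  have hW : 0 ≤ ∑ g, w g := sum_nonneg fun g _ => (hw g).le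
  rw [potential, div_le_iff₀ (reweight_pos hw v z h), potential, reweight]
  have : 3 / 4 * ((∑ g, w g) / w h) * (1 + loss v z h) * (w h * (1 - loss v z h / 2)) =
      3 / 4 * (∑ g, w g) * ((1 + loss v z h) * (1 - loss v z h / 2)) := by
    field_simp [(hw h).ne']
  rw [this]
  refine (sum_reweight_le w hQ hz).trans (le_mul_of_one_le_right (by positivity) ?_)
  -- For `x` in `[0, 1]`, `(1 + x) * (1 - x / 2) = 1 + x * (1 - x) / 2 ≥ 1`.
  nlinarith

end Vote

lemma card_mul_sum_apply {κ α : Type*} [Fintype κ] [DecidableEq κ] [Fintype α] (g : α → ℝ)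
    (i : κ) :
    (Fintype.card α : ℝ) * ∑ u : κ → α, g (u i) = Fintype.card (κ → α) * ∑ a, g a := by
  have h := Fintype.sum_piFinset_apply g univ i
  rw [Fintype.piFinset_univ] at h
  rw [h, Fintype.card_fun, nsmul_eq_mul, ← mul_assoc, card_univ]
  have : 0 < Fintype.card κ := Fintype.card_pos_iff.2 ⟨i⟩
  congr 1
  push_cast
  rw [← pow_succ', Nat.sub_add_cancel this]

/-- The indices of the examples of a sample that `f` misclassifies. -/
def mistakes {X : Type*} {m : ℕ} (f : X → Bool) (S : Fin m → X × Bool) : Finset (Fin m) :=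
  univ.filter fun j => f (S j).1 ≠ (S j).2

lemma mem_mistakes {X : Type*} {m : ℕ} {f : X → Bool} {S : Fin m → X × Bool} {j : Fin m} :
    j ∈ mistakes f S ↔ f (S j).1 ≠ (S j).2 := by
  simp [mistakes]

/-! ### Announced error rates as upper bounds. -/

section Sound

variable {ι : Type u} {k m : ℕ} (b : ℕ) (S : Fin k → Fin m → LabelledExample (ι → Bool))

/-- The error rates of `f` on the samples of the players, in `b` binary digits. -/
def levels (f : (ι → Bool) → Bool) (i : Fin k) : ℕ :=
  level b m #(mistakes f (S i))

/-- The number that is kept with a hypothesis bounds its error. -/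
def Sound (s : ℕ × ((ι → Bool) → Bool)) : Prop :=
  2 ^ b * ∑ i, #(mistakes s.2 (S i)) ≤ (s.1 + k) * m

/-- Rounding down costs each player less than one unit of the last digit or, at the cap, exactly
one; this is the `k` in `Sound`. -/
lemma sound_levels [NeZero m] (f : (ι → Bool) → Bool) : Sound b S (∑ i, levels b S f i, f) := by
  have : (∑ i, levels b S f i + k) * m = ∑ i, (levels b S f i + 1) * m := by
    rw [← sum_mul, sum_add_distrib]
    simp
  rw [Sound, this, mul_sum]
  refine sum_le_sum fun i _ => ?_
  rw [mul_comm]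
  exact le_level_add_one_mul (Nat.pos_of_neZero m) (card_finset_fin_le _)

variable {b S}

/-- The state before the first round. -/
def initialState (ι : Type u) (k b : ℕ) : (ι → ℝ) × ℕ × ((ι → Bool) → Bool) :=
  (fun _ => 1, k * 2 ^ b, fun _ => true)

lemma sound_initialState : Sound b S (initialState ι k b).2 := by
  have : ∑ i, #(mistakes (fun _ => true) (S i)) ≤ k * m := by
    refine (sum_le_sum fun i _ => card_finset_fin_le _).trans ?_
    simp
  calc 2 ^ b * ∑ i, #(mistakes (fun _ => true) (S i)) ≤ 2 ^ b * (k * m) :=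
        Nat.mul_le_mul_left _ this
    _ = k * 2 ^ b * m := by ring
    _ ≤ _ := Nat.mul_le_mul_right _ (Nat.le_add_right _ _)

end Sound

/-! ### One round, and the probability that all rounds are bad. -/

section Round

variable {ι : Type u} [Fintype ι] {k m : ℕ} (b : ℕ) [NeZero m]

/-- The messages of a round: a player sends a random example that the weighted majority vote
misclassifies, and conveys the binary digits of the error rate of the vote on its sample by
sending misclassified examples for `1` and other examples for `0`. -/
noncomputable def roundMsg (s : (ι → ℝ) × ℕ × ((ι → Bool) → Bool)) :
    Fin k × Option (Fin b) → (Fin m → LabelledExample (ι → Bool)) → Fin m.factorial → Fin m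
  | (_, none), S, a => pick (mistakes (vote s.1) S) a
  | (_, some l), S, _ =>
      if (level b m #(mistakes (vote s.1) S)).testBit l = true then pick (mistakes (vote s.1) S) 0
      else pick (mistakes (vote s.1) S)ᶜ 0

variable {b}

/-- The error rates that the messages of a round convey. -/
noncomputable def heard (w : ι → ℝ) (z : Fin k × Option (Fin b) → LabelledExample (ι → Bool))
    (i : Fin k) : ℕ :=
  Nat.ofBits fun l : Fin b => decide (vote w (z (i, some l)).1 ≠ (z (i, some l)).2)

/-- After a round the weights are updated; the vote with the least error rate is kept. -/
noncomputable def roundUpd (s : (ι → ℝ) × ℕ × ((ι → Bool) → Bool))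
    (z : Fin k × Option (Fin b) → LabelledExample (ι → Bool)) :
    (ι → ℝ) × ℕ × ((ι → Bool) → Bool) :=
  (reweight s.1 (heard s.1 z) fun i => z (i, none),
    if ∑ i, heard s.1 z i < s.2.1 then (∑ i, heard s.1 z i, vote s.1) else s.2)

variable (b) (S : Fin k → Fin m → LabelledExample (ι → Bool))

/-- The random misclassified examples that the players send. -/
noncomputable def picked (w : ι → ℝ) (u : Fin k → Fin m.factorial) (i : Fin k) :
    LabelledExample (ι → Bool) :=
  S i (pick (mistakes (vote w) (S i)) (u i))

/-- The weights after a round. -/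
noncomputable def weightStep (w : ι → ℝ) (u : Fin k → Fin m.factorial) : ι → ℝ :=
  reweight w (levels b S (vote w)) (picked S w u)

/-- Decoding is exact: whichever digit is due, an example of the required kind exists in the sample.
-/
lemma heard_answers (s : (ι → ℝ) × ℕ × ((ι → Bool) → Bool)) (u : Fin k → Fin m.factorial) :
    heard s.1 (fun a : Fin k × Option (Fin b) => S a.1 (roundMsg b s a (S a.1) (u a.1))) =
      levels b S (vote s.1) := by
  funext i
  have hm : 0 < m := Nat.pos_of_neZero m
  set M := mistakes (vote s.1) (S i) with hM
  have hc : #M ≤ m := by simpa using card_le_univ M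
  have hbit : ∀ l : Fin b, decide (vote s.1 (S i (roundMsg b s (i, some l) (S i) (u i))).1 ≠
      (S i (roundMsg b s (i, some l) (S i) (u i))).2) = (level b m #M).testBit l := by
    intro l
    rw [roundMsg, ← hM]
    cases hb : (level b m #M).testBit l with
    | true =>
      rw [if_pos rfl, decide_eq_true_iff, ← mem_mistakes]
      exact pick_mem (card_pos.1 (pos_of_testBit_level hb)) 0
    | false =>
      rw [if_neg Bool.false_ne_true, decide_eq_false_iff_not, ← mem_mistakes, ← mem_compl]
      refine pick_mem (card_pos.1 ?_) 0
      rw [card_compl, Fintype.card_fin]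
      exact Nat.sub_pos_of_lt (lt_of_testBit_level hm l.2 hc hb)
  rw [heard]
  simp only [hbit]
  rw [Nat.ofBits_testBit, Nat.mod_eq_of_lt level_lt]
  rfl

lemma playStep_round (s : (ι → ℝ) × ℕ × ((ι → Bool) → Bool)) (u : Fin k → Fin m.factorial) :
    Tree.playStep S Prod.fst (roundMsg b) roundUpd s u =
      (weightStep b S s.1 u, if ∑ i, levels b S (vote s.1) i < s.2.1 then
        (∑ i, levels b S (vote s.1) i, vote s.1) else s.2) := by
  rw [Tree.playStep, roundUpd, heard_answers]
  rfl

variable (h : ι)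

/-- The number of examples that the hypothesis `h` misclassifies. -/
def errors : ℕ := ∑ i, #(mistakes (fun x : ι → Bool => x h) (S i))

/-- The weighted majority vote is much worse than the hypothesis `h`. -/
def Bad (w : ι → ℝ) : Prop :=
  0 < ∑ i, levels b S (vote w) i ∧ 9 * 2 ^ b * errors S h ≤ (∑ i, levels b S (vote w) i) * m

variable {b S h} in
-- A random mistake of the vote in the sample of player `i` is also a mistake of `h` with
-- probability at most `#E / #M`. The factor `v i`, at most `2 ^ b * #M / m`, cancels `#M`, which
-- leaves the error rate of `h`; `Bad` compares the sum of these rates with the sum of the `v i`.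
lemma sum_loss_le {w : ι → ℝ} (hw : Bad b S h w) :
    ∑ u : Fin k → Fin m.factorial, loss (levels b S (vote w)) (picked S w u) h ≤
      Fintype.card (Fin k → Fin m.factorial) * (1 / 9) := by
  obtain ⟨hQ, hbad⟩ := hw
  set v := levels b S (vote w) with hv
  have hQ' : (0 : ℝ) < ∑ i, (v i : ℝ) := by exact_mod_cast hQ
  have hm : (0 : ℝ) < m := by exact_mod_cast Nat.pos_of_neZero m
  have hf : (0 : ℝ) < m.factorial := by exact_mod_cast m.factorial_pos
  set N : ℝ := ((Fintype.card (Fin k → Fin m.factorial) : ℕ) : ℝ) with hN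
  have hN0 : 0 ≤ N := Nat.cast_nonneg _
  have player : ∀ i, ∑ u : Fin k → Fin m.factorial,
      (if (picked S w u i).1 h ≠ (picked S w u i).2 then (v i : ℝ) else 0) ≤
        N * (2 ^ b * #(mistakes (fun x : ι → Bool => x h) (S i)) / m) := by
    intro i
    set M := mistakes (vote w) (S i) with hM
    set E := mistakes (fun x : ι → Bool => x h) (S i) with hE
    set g : Fin m → ℝ := fun j => if j ∈ E then 1 else 0 with hg
    have e1 : ∑ u : Fin k → Fin m.factorial,
        (if (picked S w u i).1 h ≠ (picked S w u i).2 then (v i : ℝ) else 0) =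
        v i * ∑ u : Fin k → Fin m.factorial, g (pick M (u i)) := by
      rw [mul_sum]
      refine sum_congr rfl fun u _ => ?_
      simp only [hg, hE, mem_mistakes, picked, mul_ite, mul_one, mul_zero, ← hM]
    have e2 := card_mul_sum_apply (κ := Fin k) (fun a : Fin m.factorial => g (pick M a)) i
    rw [Fintype.card_fin, ← hN] at e2
    rcases M.eq_empty_or_nonempty with h0 | hne
    -- Without mistakes `pick` returns an arbitrary example, but then the sender has weight zero.
    · have : v i = 0 := by simp [hv, levels, ← hM, h0, level]
      rw [e1, this, Nat.cast_zero, zero_mul]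
      positivity
    have e3 := card_mul_sum_pick hne g
    have hMpos : (0 : ℝ) < #M := by exact_mod_cast hne.card_pos
    have hgE : ∑ j ∈ M, g j ≤ #E := by
      rw [hg, sum_boole]
      exact_mod_cast card_le_card fun j hj => (mem_filter.1 hj).2
    have hvi : (v i : ℝ) * m ≤ #M * 2 ^ b := by
      exact_mod_cast level_mul_le (b := b) (m := m) (c := #M)
    have e4 : ∑ u : Fin k → Fin m.factorial, g (pick M (u i)) = N * (∑ j ∈ M, g j) / #M := by
      rw [eq_div_iff hMpos.ne']
      have : (m.factorial : ℝ) * ((∑ u : Fin k → Fin m.factorial, g (pick M (u i))) * #M) =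
          m.factorial * (N * ∑ j ∈ M, g j) := by
        calc _ = #M * (m.factorial * ∑ u : Fin k → Fin m.factorial, g (pick M (u i))) := by ring
          _ = N * (#M * ∑ a : Fin m.factorial, g (pick M a)) := by rw [e2]; ring
          _ = _ := by rw [e3]; ring
      exact mul_left_cancel₀ hf.ne' this
    rw [e1, e4]
    have hG : 0 ≤ ∑ j ∈ M, g j := sum_nonneg fun j _ => by simp only [hg]; positivity
    have : (v i : ℝ) / #M ≤ 2 ^ b / m := by
      rw [div_le_div_iff₀ hMpos hm]
      linarith
    calc (v i : ℝ) * (N * (∑ j ∈ M, g j) / #M) = N * (v i / #M * ∑ j ∈ M, g j) := by ring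
      _ ≤ N * (2 ^ b / m * #E) :=
        mul_le_mul_of_nonneg_left (mul_le_mul this hgE hG (by positivity)) hN0
      _ = _ := by ring
  simp only [loss]
  rw [← sum_div, sum_comm, div_le_iff₀ hQ']
  refine (sum_le_sum fun i _ => player i).trans ?_
  rw [← mul_sum, mul_assoc]
  refine mul_le_mul_of_nonneg_left ?_ hN0
  rw [← sum_div, ← mul_sum, div_le_iff₀ hm]
  have : (9 : ℝ) * 2 ^ b * ∑ i, (#(mistakes (fun x : ι → Bool => x h) (S i)) : ℝ) ≤
      (∑ i, (v i : ℝ)) * m := by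
    exact_mod_cast hbad
  linarith

variable {b S h} in
lemma sum_potential_le {w : ι → ℝ} (hpos : ∀ g, 0 < w g) (hw : Bad b S h w) :
    ∑ u : Fin k → Fin m.factorial, potential h (weightStep b S w u) ≤
      5 / 6 * Fintype.card (Fin k → Fin m.factorial) * potential h w := by
  have hR : 0 ≤ potential h w := zero_le_one.trans (one_le_potential hpos h)
  have hz : ∀ u : Fin k → Fin m.factorial, ∀ i, 0 < levels b S (vote w) i →
      vote w (picked S w u i).1 ≠ (picked S w u i).2 := by
    intro u i hi
    rw [picked, ← mem_mistakes]
    refine pick_mem (nonempty_iff_ne_empty.2 fun h0 => ?_) _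
    simp [levels, level, h0] at hi
  calc _ ≤ ∑ u : Fin k → Fin m.factorial, 3 / 4 * potential h w *
        (1 + loss (levels b S (vote w)) (picked S w u) h) :=
        sum_le_sum fun u _ => potential_reweight_le hpos h hw.1 (hz u)
    _ = 3 / 4 * potential h w * (Fintype.card (Fin k → Fin m.factorial) +
        ∑ u : Fin k → Fin m.factorial, loss (levels b S (vote w)) (picked S w u) h) := by
        rw [← mul_sum, sum_add_distrib, sum_const, card_univ, nsmul_one]
    _ ≤ 3 / 4 * potential h w * (Fintype.card (Fin k → Fin m.factorial) +
        Fintype.card (Fin k → Fin m.factorial) * (1 / 9)) := by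
        gcongr
        exact sum_loss_le hw
    _ = _ := by ring

/-- The weighted majority vote is much worse than the hypothesis `h` in each of `n` rounds. -/
def AllBad : (n : ℕ) → (Fin n → Fin k → Fin m.factorial) → (ι → ℝ) → Prop
  | 0, _, _ => True
  | n + 1, u, w => Bad b S h w ∧ AllBad n (Fin.tail u) (weightStep b S w (u 0))

open Classical in
-- Markov's inequality unrolled: the potential is at least 1 after the last round, and the induction
-- conditions on the seeds of the first round.
lemma card_allBad_le (n : ℕ) {w : ι → ℝ} (hpos : ∀ g, 0 < w g) :
    (#{u : Fin n → Fin k → Fin m.factorial | AllBad b S h n u w} : ℝ) ≤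
      (5 / 6 * Fintype.card (Fin k → Fin m.factorial)) ^ n * potential h w := by
  induction n generalizing w with
  | zero =>
    simp only [AllBad, pow_zero, one_mul]
    simpa using one_le_potential hpos h
  | succ n ih =>
    have hR : 0 ≤ potential h w := zero_le_one.trans (one_le_potential hpos h)
    by_cases hw : Bad b S h w
    · have e : (#{u : Fin (n + 1) → Fin k → Fin m.factorial | AllBad b S h (n + 1) u w} : ℝ) =
          ∑ u0 : Fin k → Fin m.factorial, (#{u : Fin n → Fin k → Fin m.factorial |
            AllBad b S h n u (weightStep b S w u0)} : ℝ) := by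
        simp_rw [← sum_boole]
        rw [← Fintype.sum_prod_type']
        refine (Fintype.sum_equiv (Fin.consEquiv fun _ => Fin k → Fin m.factorial) _ _ ?_).symm
        rintro ⟨u0, u⟩
        simp only [AllBad, Fin.consEquiv_apply, Fin.cons_zero, hw, true_and]
        rfl
      rw [e]
      calc _ ≤ ∑ u0 : Fin k → Fin m.factorial,
            (5 / 6 * (Fintype.card (Fin k → Fin m.factorial) : ℝ)) ^ n *
              potential h (weightStep b S w u0) :=
            sum_le_sum fun u0 _ => ih (reweight_pos hpos _ _)
        _ = (5 / 6 * (Fintype.card (Fin k → Fin m.factorial) : ℝ)) ^ n *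
              ∑ u0 : Fin k → Fin m.factorial, potential h (weightStep b S w u0) := by
            rw [mul_sum]
        _ ≤ (5 / 6 * (Fintype.card (Fin k → Fin m.factorial) : ℝ)) ^ n *
              (5 / 6 * Fintype.card (Fin k → Fin m.factorial) * potential h w) := by
            gcongr
            exact sum_potential_le hpos hw
        _ = _ := by ring
    · simp only [AllBad, hw, false_and, filter_false, card_empty, Nat.cast_zero]
      positivity

/-- The state of the protocol after `n` rounds. -/
noncomputable abbrev roundsRun (n : ℕ) (u : Fin n → Fin k → Fin m.factorial)
    (s : (ι → ℝ) × ℕ × ((ι → Bool) → Bool)) : (ι → ℝ) × ℕ × ((ι → Bool) → Bool) :=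
  Tree.playRun S Prod.fst (roundMsg b) roundUpd n u s

variable {b S} in
lemma sound_roundsRun (n : ℕ) (u : Fin n → Fin k → Fin m.factorial)
    {s : (ι → ℝ) × ℕ × ((ι → Bool) → Bool)} (hs : Sound b S s.2) :
    Sound b S (roundsRun b S n u s).2 := by
  induction n generalizing s with
  | zero => exact hs
  | succ n ih =>
    refine ih (Fin.tail u) ?_
    rw [playStep_round]
    dsimp only
    split_ifs
    exacts [sound_levels b S _, hs]

lemma roundsRun_le (n : ℕ) (u : Fin n → Fin k → Fin m.factorial)
    (s : (ι → ℝ) × ℕ × ((ι → Bool) → Bool)) : (roundsRun b S n u s).2.1 ≤ s.2.1 := by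
  induction n generalizing s with
  | zero => exact le_rfl
  | succ n ih =>
    refine (ih (Fin.tail u) _).trans ?_
    rw [playStep_round]
    dsimp only
    split_ifs with hlt
    exacts [hlt.le, le_rfl]

variable {b S h} in
-- The kept number never increases, and in a round that is not bad it becomes at most the number
-- announced for the current vote.
lemma roundsRun_mul_le (n : ℕ) (u : Fin n → Fin k → Fin m.factorial)
    {s : (ι → ℝ) × ℕ × ((ι → Bool) → Bool)} (hu : ¬ AllBad b S h n u s.1) :
    (roundsRun b S n u s).2.1 * m ≤ 9 * 2 ^ b * errors S h := by
  induction n generalizing s with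
  | zero => exact absurd trivial hu
  | succ n ih =>
    by_cases hw : Bad b S h s.1
    · refine ih (Fin.tail u) ?_
      rw [playStep_round]
      exact fun hall => hu ⟨hw, hall⟩
    · have h1 : (roundsRun b S (n + 1) u s).2.1 ≤ ∑ i, levels b S (vote s.1) i := by
        refine (roundsRun_le b S n (Fin.tail u) _).trans ?_
        rw [playStep_round]
        dsimp only
        split_ifs with hlt
        exacts [le_rfl, not_lt.1 hlt]
      refine (Nat.mul_le_mul_right m h1).trans ?_
      rw [Bad, not_and_or, not_lt, not_le] at hw
      -- A round also fails to be bad when all announced rates are zero; then the kept number is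
      -- zero.
      rcases hw with hw | hw
      · simp [Nat.le_zero.1 hw]
      · exact hw.le

end Round

open ProbabilityTheory

/-! ### From samples to distributions. -/

section Deviation

/-- **Chebyshev's inequality** for empirical frequencies. -/
lemma measure_pi_frequency_le {Z : Type*} [MeasurableSpace Z] (μ : Measure Z)
    [IsProbabilityMeasure μ] {A : Set Z} (hA : MeasurableSet A) {m : ℕ} (hm : 0 < m) {η : ℝ}
    (hη : 0 < η) :
    (Measure.pi fun _ : Fin m => μ) {z | η ≤ |(∑ j, A.indicator 1 (z j)) / m - μ.real A|} ≤
      ENNReal.ofReal (1 / (m * η ^ 2)) := by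
  have hm' : (0 : ℝ) < m := by exact_mod_cast hm
  set g : Z → ℝ := A.indicator 1 with hg
  have hgm : Measurable g := measurable_one.indicator hA
  have hb : ∀ z, g z ∈ Set.Icc (0 : ℝ) 1 := fun z => by
    by_cases h : z ∈ A <;> simp [hg, h]
  have hL : MemLp g 2 μ := memLp_of_bounded (Filter.Eventually.of_forall hb)
    hgm.aestronglyMeasurable 2
  have hLi : ∀ j : Fin m, MemLp (fun z : Fin m → Z => g (z j)) 2 (Measure.pi fun _ => μ) :=
    fun j => hL.comp_measurePreserving (measurePreserving_eval (fun _ : Fin m => μ) j)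
  have hX : MemLp (∑ j : Fin m, fun z : Fin m → Z => g (z j)) 2 (Measure.pi fun _ => μ) :=
    memLp_finsetSum' _ fun j _ => hLi j
  have hvar : Var[∑ j : Fin m, fun z : Fin m → Z => g (z j); Measure.pi fun _ => μ] ≤ m := by
    rw [variance_sum_pi fun _ => hL]
    have hv : Var[g; μ] ≤ 1 :=
      (variance_le_sq_of_bounded (Filter.Eventually.of_forall hb) hgm.aemeasurable).trans
        (by norm_num)
    refine (sum_le_sum fun _ _ => hv).trans ?_
    simp
  have hmean : (Measure.pi fun _ : Fin m => μ)[∑ j : Fin m, fun z : Fin m → Z => g (z j)] =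
      m * μ.real A := by
    have h1 : ∀ j : Fin m, ∫ z, g (z j) ∂(Measure.pi fun _ : Fin m => μ) = μ.real A := by
      intro j
      rw [integral_comp_eval (μ := fun _ : Fin m => μ) hgm.aestronglyMeasurable, hg,
        integral_indicator_one hA]
    simp only [Finset.sum_apply]
    rw [integral_finsetSum _ fun j _ => (hLi j).integrable one_le_two]
    simp [h1]
  have hcheb := meas_ge_le_variance_div_sq hX (mul_pos hm' hη)
  rw [hmean] at hcheb
  refine (measure_mono fun z hz => ?_).trans (hcheb.trans (ENNReal.ofReal_le_ofReal ?_))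
  · simp only [Set.mem_ofPred_eq, Finset.sum_apply] at hz ⊢
    have : (∑ j, g (z j)) - m * μ.real A = m * ((∑ j, g (z j)) / m - μ.real A) := by
      field_simp
    rw [this, abs_mul, abs_of_pos hm']
    exact mul_le_mul_of_nonneg_left hz hm'.le
  · rw [div_le_div_iff₀ (by positivity) (by positivity), one_mul]
    calc _ ≤ (m : ℝ) * (m * η ^ 2) := mul_le_mul_of_nonneg_right hvar (by positivity)
      _ = _ := by ring

end Deviation

section Accurate

variable {X : Type u} [MeasurableSpace X] {k m : ℕ}

/-- The error rates of all classifiers on the samples are close to their errors on the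
distributions of the players. -/
def Accurate (D : Fin k → Measure (LabelledExample X)) (η : ℝ)
    (S : Fin k → Fin m → LabelledExample X) : Prop :=
  ∀ i, ∀ f : X → Bool, |(#(mistakes f (S i)) : ℝ) / m - err (D i) f| < η

/-- The bound must be uniform over all classifiers, because the votes depend on the samples; there
are finitely many on a finite space. -/
lemma measure_not_accurate_le [Finite X] [MeasurableSingletonClass X]
    (D : Fin k → Measure (LabelledExample X)) [∀ i, IsProbabilityMeasure (D i)] (hm : 0 < m)
    {η : ℝ} (hη : 0 < η) :
    (Measure.pi fun i => Measure.pi fun _ : Fin m => D i) {S | ¬ Accurate D η S} ≤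
      ENNReal.ofReal (k * Nat.card (X → Bool) / (m * η ^ 2)) := by
  have := Fintype.ofFinite (X → Bool)
  have hsub : {S : Fin k → Fin m → LabelledExample X | ¬ Accurate D η S} ⊆
      ⋃ a : Fin k × (X → Bool), Function.eval a.1 ⁻¹'
        {z : Fin m → LabelledExample X | η ≤ |(#(mistakes a.2 z) : ℝ) / m - err (D a.1) a.2|} := by
    intro S hS
    simp only [Accurate, Set.mem_ofPred_eq, not_forall, not_lt] at hS
    obtain ⟨i, f, hif⟩ := hS
    exact Set.mem_iUnion.2 ⟨(i, f), hif⟩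
  have hone : ∀ a : Fin k × (X → Bool), (Measure.pi fun i => Measure.pi fun _ : Fin m => D i)
      (Function.eval a.1 ⁻¹'
        {z : Fin m → LabelledExample X | η ≤ |(#(mistakes a.2 z) : ℝ) / m - err (D a.1) a.2|}) ≤
      ENNReal.ofReal (1 / (m * η ^ 2)) := by
    rintro ⟨i, f⟩
    rw [(measurePreserving_eval (fun i => Measure.pi fun _ : Fin m => D i) i).measure_preimage
      (Set.toFinite _).measurableSet.nullMeasurableSet]
    refine (measure_mono fun z hz => ?_).trans (measure_pi_frequency_le (D i)
      (A := {z | f z.1 ≠ z.2}) (Set.toFinite _).measurableSet hm hη)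
    have : (#(mistakes f z) : ℝ) =
        ∑ j, ({z | f z.1 ≠ z.2} : Set (LabelledExample X)).indicator 1 (z j) := by
      rw [mistakes, ← sum_boole]
      exact sum_congr rfl fun j _ => by simp [Set.indicator_apply]
    rw [Set.mem_ofPred_eq, this] at hz
    exact hz
  refine (measure_mono hsub).trans ((measure_iUnion_fintype_le _ _).trans
    ((sum_le_sum fun a _ => hone a).trans ?_))
  rw [sum_const, card_univ, Fintype.card_prod, Fintype.card_fin, Nat.card_eq_fintype_card,
    nsmul_eq_mul, ← ENNReal.ofReal_natCast, ← ENNReal.ofReal_mul (Nat.cast_nonneg _)]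
  apply ENNReal.ofReal_le_ofReal
  push_cast
  rw [mul_one_div]

lemma err_mixture (D : Fin k → Measure (LabelledExample X)) [∀ i, IsProbabilityMeasure (D i)]
    (f : X → Bool) : err (mixture D) f = (∑ i, err (D i) f) / k := by
  rw [err, mixture, measureReal_ennreal_smul_apply, measureReal_def, Measure.finsetSum_apply,
    ENNReal.toReal_sum fun i _ => measure_ne_top _ _, ENNReal.toReal_inv, ENNReal.toReal_natCast,
    div_eq_inv_mul]
  rfl

lemma Accurate.abs_sub_le {D : Fin k → Measure (LabelledExample X)}
    [∀ i, IsProbabilityMeasure (D i)] {η : ℝ} {S : Fin k → Fin m → LabelledExample X}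
    (hS : Accurate D η S) (hk : 0 < k) (f : X → Bool) :
    |(∑ i, (#(mistakes f (S i)) : ℝ) / m) / k - err (mixture D) f| ≤ η := by
  have hk' : (0 : ℝ) < k := by exact_mod_cast hk
  rw [err_mixture, ← sub_div, ← sum_sub_distrib, abs_div, abs_of_pos hk', div_le_iff₀ hk']
  refine (abs_sum_le_sum_abs _ _).trans ((sum_le_sum fun i _ => (hS i f).le).trans ?_)
  simp [mul_comm]

end Accurate

/-! ### Transport of runs and errors along a measurable map. -/

namespace Protocol

/-- Run a protocol for `Y` on the images of instances in `X`. -/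
def comap {X Y : Type u} {k : ℕ} (φ : X → Y) (π : Protocol Y k) : Protocol X k :=
  ⟨π.m, π.q, π.p, fun s => (π.tree s).comap φ⟩

variable {X Y : Type u} {k : ℕ} (φ : X → Y) (π : Protocol Y k)

/-- The run on the images of the instances. -/
def mapRun (ω : (π.comap φ).Seeds × (π.comap φ).Samples) : π.Seeds × π.Samples :=
  (ω.1, fun i j => Tree.mapExample φ (ω.2 i j))

lemma output_comap (ω : (π.comap φ).Seeds × (π.comap φ).Samples) :
    (π.comap φ).output ω = π.output (π.mapRun φ ω) ∘ φ :=
  Tree.hypothesis_comap φ ω.2 ω.1.2 (π.tree ω.1.1)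

lemma bitCost_comap (ω : (π.comap φ).Seeds × (π.comap φ).Samples) :
    (π.comap φ).bitCost ω = π.bitCost (π.mapRun φ ω) :=
  Tree.bits_comap φ ω.2 ω.1.2 (π.tree ω.1.1)

lemma exampleCost_comap (ω : (π.comap φ).Seeds × (π.comap φ).Samples) :
    (π.comap φ).exampleCost ω = π.exampleCost (π.mapRun φ ω) :=
  Tree.examples_comap φ ω.2 ω.1.2 (π.tree ω.1.1)

variable [MeasurableSpace X] [MeasurableSpace Y]

lemma measurable_mapExample {φ : X → Y} (hφ : Measurable φ) :
    Measurable (Tree.mapExample φ) :=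
  (hφ.comp measurable_fst).prodMk measurable_snd

variable {φ} in
lemma map_law_comap (hφ : Measurable φ) (D : Fin k → Measure (LabelledExample X))
    [∀ i, IsProbabilityMeasure (D i)] :
    ((π.comap φ).law D).map (π.mapRun φ) = π.law fun i => (D i).map (Tree.mapExample φ) := by
  have hm := measurable_mapExample hφ
  have : ∀ i, IsProbabilityMeasure ((D i).map (Tree.mapExample φ)) :=
    fun i => Measure.isProbabilityMeasure_map hm.aemeasurable
  have h1 : (Measure.pi fun i => Measure.pi fun _ : Fin π.m => D i).map
      (fun S i j => Tree.mapExample φ (S i j)) =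
      Measure.pi fun i => Measure.pi fun _ : Fin π.m => (D i).map (Tree.mapExample φ) := by
    have h2 : ∀ i, (Measure.pi fun _ : Fin π.m => D i).map (fun S j => Tree.mapExample φ (S j)) =
        Measure.pi fun _ : Fin π.m => (D i).map (Tree.mapExample φ) :=
      fun i => Measure.pi_map_pi fun _ => hm.aemeasurable
    have hm2 : Measurable fun (S : Fin π.m → LabelledExample X) j => Tree.mapExample φ (S j) :=
      measurable_pi_lambda _ fun j => hm.comp (measurable_pi_apply j)
    have : ∀ i, SigmaFinite ((Measure.pi fun _ : Fin π.m => D i).map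
        (fun S j => Tree.mapExample φ (S j))) := fun i => by rw [h2 i]; infer_instance
    have h3 := Measure.pi_map_pi (μ := fun i => Measure.pi fun _ : Fin π.m => D i)
      (f := fun (_ : Fin k) (S : Fin π.m → LabelledExample X) j => Tree.mapExample φ (S j))
      fun _ => hm2.aemeasurable
    rw [h3]
    simp_rw [h2]
  have hmS : Measurable fun (S : Fin k → Fin π.m → LabelledExample X) i j =>
      Tree.mapExample φ (S i j) :=
    measurable_pi_lambda _ fun i => measurable_pi_lambda _ fun j =>
      hm.comp ((measurable_pi_apply j).comp (measurable_pi_apply i))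
  rw [law, law, ← h1]
  conv_rhs => rw [← Measure.map_id (μ := (PMF.uniformOfFintype π.Seeds).toMeasure)]
  rw [Measure.map_prod_map _ _ measurable_id hmS]
  rfl

end Protocol

lemma err_mixture_map {X Y : Type u} [MeasurableSpace X] [MeasurableSpace Y] [Finite Y]
    [MeasurableSingletonClass Y] {φ : X → Y} (hφ : Measurable φ) {k : ℕ}
    (D : Fin k → Measure (LabelledExample X)) [∀ i, IsProbabilityMeasure (D i)] (f : Y → Bool) :
    err (mixture fun i => (D i).map (Tree.mapExample φ)) f = err (mixture D) (f ∘ φ) := by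
  have hm := Protocol.measurable_mapExample hφ
  have : ∀ i, IsProbabilityMeasure ((D i).map (Tree.mapExample φ)) :=
    fun i => Measure.isProbabilityMeasure_map hm.aemeasurable
  rw [err_mixture, err_mixture]
  congr 1
  refine sum_congr rfl fun i _ => ?_
  rw [err, map_measureReal_apply hm (Set.toFinite _).measurableSet]
  rfl

lemma div_div_le_of_two_pow_mul_le {a c m k : ℝ} (hm : 0 < m) (hk : 0 < k) {b : ℕ}
    (h : 2 ^ b * a ≤ 9 * 2 ^ b * c + k * m) : a / m / k ≤ 9 * (c / m / k) + (1 / 2) ^ b := by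
  have hb : (0 : ℝ) < 2 ^ b := by positivity
  have e : 9 * (c / m / k) + (1 / 2) ^ b = (9 * 2 ^ b * c + k * m) / (2 ^ b * (m * k)) := by
    rw [one_div, inv_pow]
    field_simp
  rw [e, div_div, div_le_div_iff₀ (by positivity) (by positivity)]
  calc a * (2 ^ b * (m * k)) = 2 ^ b * a * (m * k) := by ring
    _ ≤ _ := mul_le_mul_of_nonneg_right h (by positivity)

/-! ### Correctness of the voting protocol. -/

section Voting

variable {ι : Type u} [Fintype ι] {k m : ℕ} [NeZero m] {b : ℕ}
  {S : Fin k → Fin m → LabelledExample (ι → Bool)}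

lemma err_le_of_not_allBad {D : Fin k → Measure (LabelledExample (ι → Bool))}
    [∀ i, IsProbabilityMeasure (D i)] {η : ℝ} (hS : Accurate D η S) (hk : 0 < k) {n : ℕ}
    {u : Fin n → Fin k → Fin m.factorial} {h : ι} (hu : ¬ AllBad b S h n u fun _ => 1) :
    err (mixture D) (roundsRun b S n u (initialState ι k b)).2.2 ≤
      9 * err (mixture D) (fun x => x h) + (10 * η + (1 / 2) ^ b) := by
  set s := (roundsRun b S n u (initialState ι k b)).2 with hs
  have h1 : Sound b S s := sound_roundsRun n u sound_initialState
  have h2 : s.1 * m ≤ 9 * 2 ^ b * errors S h :=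
    roundsRun_mul_le n u (s := initialState ι k b) hu
  have hm : (0 : ℝ) < m := by exact_mod_cast Nat.pos_of_neZero m
  have hk' : (0 : ℝ) < k := by exact_mod_cast hk
  have hf := abs_le.1 (hS.abs_sub_le hk s.2)
  have hh := abs_le.1 (hS.abs_sub_le hk fun x => x h)
  rw [← sum_div] at hf hh
  have h3 : (2 : ℝ) ^ b * ∑ i, (#(mistakes s.2 (S i)) : ℝ) ≤
      9 * 2 ^ b * (∑ i, (#(mistakes (fun x : ι → Bool => x h) (S i)) : ℝ)) + k * m := by
    have : 2 ^ b * ∑ i, #(mistakes s.2 (S i)) ≤ 9 * 2 ^ b * errors S h + k * m :=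
      h1.trans (by rw [add_mul]; exact Nat.add_le_add_right h2 _)
    rw [errors] at this
    exact_mod_cast this
  have h4 : (∑ i, (#(mistakes s.2 (S i)) : ℝ)) / m / k ≤
      9 * ((∑ i, (#(mistakes (fun x : ι → Bool => x h) (S i)) : ℝ)) / m / k) + (1 / 2) ^ b :=
    div_div_le_of_two_pow_mul_le hm hk' h3
  linarith [hf.1, hh.2]

/-- The distributed multiplicative weights protocol for a finite class of hypotheses. -/
lemma exists_voting_protocol (ι : Type u) [Fintype ι] {k : ℕ} (hk : 0 < k) {n b : ℕ} {ε δ : ℝ}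
    (hε : 0 < ε) (hδ : 0 < δ) (hn : Fintype.card ι * (5 / 6 : ℝ) ^ n ≤ δ / 2)
    (hb : (1 / 2 : ℝ) ^ b ≤ ε / 2) :
    ∃ π : Protocol (ι → Bool) k, π.p = 0 ∧
      (∀ D : Fin k → Measure (LabelledExample (ι → Bool)), (∀ i, IsProbabilityMeasure (D i)) →
        ∀ h : ι, π.law D {ω | ¬ err (mixture D) (π.output ω) ≤
          9 * err (mixture D) (fun x => x h) + ε} ≤ ENNReal.ofReal δ) ∧
      ∀ ω, π.exampleCost ω = n * (k * (b + 1)) ∧ π.bitCost ω = 0 := by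
  -- The deviation enters once for the output and 9 times for `h`; `10 * η = ε / 2` leaves `ε / 2`
  -- for rounding.
  set η := ε / 20 with hη
  have hη0 : 0 < η := by positivity
  obtain ⟨m, hm⟩ := exists_nat_gt
    ((k * Nat.card ((ι → Bool) → Bool) : ℝ) / (η ^ 2 * (δ / 2)))
  have hm0 : (0 : ℝ) < m := lt_of_le_of_lt (by positivity) hm
  have hm1 : 0 < m := by exact_mod_cast hm0
  have : NeZero m := ⟨hm1.ne'⟩
  have : NeZero m.factorial := ⟨m.factorial_ne_zero⟩
  obtain ⟨q, ⟨e⟩⟩ : ∃ q, Nonempty (Fin (q + 1) ≃ (Fin n → Fin m.factorial)) := by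
    have hpos : 0 < Fintype.card (Fin n → Fin m.factorial) := Fintype.card_pos
    refine ⟨Fintype.card (Fin n → Fin m.factorial) - 1, ⟨?_⟩⟩
    exact (finCongr (Nat.sub_add_cancel hpos)).trans (Fintype.equivFin _).symm
  let π : Protocol (ι → Bool) k := ⟨m, q, 0, fun _ =>
    Tree.play Prod.fst (roundMsg b) roundUpd (fun s => s.2.2) n e (initialState ι k b)⟩
  refine ⟨π, rfl, fun D hD h => ?_, fun ω => ⟨?_, Tree.bits_play ..⟩⟩
  swap
  · refine (Tree.examples_play ..).trans ?_
    simp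
  have : Unique (Fin (π.p + 1)) := inferInstanceAs (Unique (Fin 1))
  -- A private seed encodes one index for each round; regrouping by rounds makes the indices of
  -- different rounds independent and uniform.
  let E : π.Seeds ≃ (Fin n → Fin k → Fin m.factorial) :=
    (Equiv.uniqueProd _ _).trans ((Equiv.piCongrRight fun _ => e).trans (Equiv.piComm _))
  have hout : ∀ ω, π.output ω = (roundsRun b ω.2 n (E ω.1) (initialState ι k b)).2.2 :=
    fun ω => Tree.hypothesis_play ..
  classical
  have hseed : ∀ S : π.Samples, (PMF.uniformOfFintype π.Seeds).toMeasure
      {s | AllBad b S h n (E s) fun _ => 1} ≤ ENNReal.ofReal (δ / 2) := by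
    intro S
    have hcard : Fintype.card π.Seeds = Fintype.card (Fin n → Fin k → Fin m.factorial) :=
      Fintype.card_congr E
    have hpos : (0 : ℝ) < Fintype.card π.Seeds := by exact_mod_cast Fintype.card_pos
    have hc : (#{s : π.Seeds | AllBad b S h n (E s) fun _ => 1} : ℝ) ≤
        δ / 2 * Fintype.card π.Seeds := by
      have h1 : #{s : π.Seeds | AllBad b S h n (E s) fun _ => 1} =
          #{u : Fin n → Fin k → Fin m.factorial | AllBad b S h n u fun _ => 1} :=
        card_equiv E (by simp)
      have h2 := card_allBad_le b S h n (w := fun _ => 1) fun _ => one_pos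
      rw [h1, hcard, Fintype.card_fun (α := Fin n), Fintype.card_fin n]
      refine h2.trans ?_
      rw [mul_pow, potential, div_one, sum_const, card_univ, nsmul_one]
      push_cast
      calc _ = Fintype.card ι * (5 / 6 : ℝ) ^ n *
            (Fintype.card (Fin k → Fin m.factorial) : ℝ) ^ n := by ring
        _ ≤ δ / 2 * (Fintype.card (Fin k → Fin m.factorial) : ℝ) ^ n := by gcongr
        _ = _ := by rfl
    rw [PMF.toMeasure_uniformOfFintype_apply _ (Set.toFinite _).measurableSet,
      ← ENNReal.ofReal_natCast, ← ENNReal.ofReal_natCast, ← ENNReal.ofReal_div_of_pos hpos]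
    apply ENNReal.ofReal_le_ofReal
    rw [div_le_iff₀ hpos]
    refine le_of_eq_of_le (congrArg Nat.cast ?_) hc
    exact Fintype.card_of_subtype _ (by simp)
  have hsub : {ω | ¬ err (mixture D) (π.output ω) ≤ 9 * err (mixture D) (fun x => x h) + ε} ⊆
      Set.univ ×ˢ {S | ¬ Accurate D η S} ∪
        {ω : π.Seeds × π.Samples | AllBad b ω.2 h n (E ω.1) fun _ => 1} := by
    intro ω hω
    by_contra hcon
    simp only [Set.mem_union, Set.mem_prod, Set.mem_univ, true_and, Set.mem_ofPred_eq, not_or,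
      not_not] at hcon
    refine hω ?_
    rw [hout]
    refine (err_le_of_not_allBad hcon.1 hk hcon.2).trans ?_
    rw [hη]
    linarith
  have hS : (Measure.pi fun i => Measure.pi fun _ : Fin m => D i) {S | ¬ Accurate D η S} ≤
      ENNReal.ofReal (δ / 2) := by
    refine (measure_not_accurate_le D hm1 hη0).trans (ENNReal.ofReal_le_ofReal ?_)
    rw [div_lt_iff₀ (by positivity)] at hm
    rw [div_le_iff₀ (by positivity)]
    linarith
  refine (measure_mono hsub).trans ((measure_union_le _ _).trans ?_)
  rw [← add_halves δ, ENNReal.ofReal_add (by positivity) (by positivity)]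
  refine add_le_add ?_ ?_
  · rw [Protocol.law, Measure.prod_prod, measure_univ, one_mul]
    exact hS
  -- The bound over the seeds holds for every fixed sample, so Fubini applies with the samples
  -- outside.
  · rw [Protocol.law, Measure.prod_apply_symm (Set.toFinite _).measurableSet]
    refine (lintegral_mono fun S => hseed S).trans ?_
    simp

end Voting

lemma le_two_rpow_lg {t : ℝ} (ht : 0 < t) : t ≤ 2 ^ lg t := by
  calc t = 2 ^ Real.logb 2 t := (Real.rpow_logb two_pos (by norm_num) ht).symm
    _ ≤ _ := Real.rpow_le_rpow_of_exponent_le one_le_two (le_max_right _ _)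

lemma one_le_lg (t : ℝ) : 1 ≤ lg t := le_max_left _ _

/-- The multiplicative weights protocol, for a class of measurable hypotheses on any space. -/
lemma exists_protocol {X : Type u} [MeasurableSpace X] {H : Finset (X → Bool)} (hH : H.Nonempty)
    (hmeas : ∀ h ∈ H, Measurable h) {k : ℕ} (hk : 0 < k) {n b : ℕ} {ε δ : ℝ}
    (hε : 0 < ε) (hδ : 0 < δ) (hn : #H * (5 / 6 : ℝ) ^ n ≤ δ / 2)
    (hb : (1 / 2 : ℝ) ^ b ≤ ε / 2) :
    ∃ π : Protocol X k, π.NoSharedRandomness ∧ AgnosticallyLearns π H 9 ε δ ∧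
      ∀ ω, π.exampleCost ω = n * (k * (b + 1)) ∧ π.bitCost ω = 0 := by
  obtain ⟨π, hp, hlearn, hcost⟩ := exists_voting_protocol H hk (n := n) (b := b) hε hδ
    (by rwa [Fintype.card_coe]) hb
  -- The protocol sees an instance only through its labels under the class, a point of a finite
  -- space on which every vote is measurable.
  let φ : X → H → Bool := fun x h => h.1 x
  have hφ : Measurable φ := measurable_pi_lambda _ fun h => hmeas h.1 h.2
  refine ⟨π.comap φ, hp, ⟨fun ω => ?_, fun D hD => ?_⟩, fun ω => ?_⟩
  · rw [π.output_comap]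
    exact (measurable_of_finite _).comp hφ
  · have : Nonempty H := hH.to_subtype
    obtain ⟨h, hh⟩ := exists_eq_ciInf_of_finite (f := fun h : H => err (mixture D) h)
    have hmap : ∀ i, IsProbabilityMeasure ((D i).map (Tree.mapExample φ)) :=
      fun i => Measure.isProbabilityMeasure_map (Protocol.measurable_mapExample hφ).aemeasurable
    have key := hlearn (fun i => (D i).map (Tree.mapExample φ)) hmap h
    have hmr : Measurable (π.mapRun φ) :=
      measurable_fst.prodMk (measurable_pi_lambda _ fun i => measurable_pi_lambda _ fun j =>
        (Protocol.measurable_mapExample hφ).comp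
          ((measurable_pi_apply j).comp ((measurable_pi_apply i).comp measurable_snd)))
    rw [← π.map_law_comap hφ, Measure.map_apply hmr (Set.toFinite _).measurableSet] at key
    refine le_of_eq_of_le (congrArg _ ?_) key
    ext ω
    simp only [Set.mem_preimage, Set.mem_ofPred_eq, err_mixture_map hφ, π.output_comap]
    rw [opt, ← hh]
    rfl
  · rw [π.exampleCost_comap, π.bitCost_comap]
    exact hcost _

end DistLearning

/-! ### Choice of the parameters. -/

open DistLearning
theorem theorem11 :
    ∃ c : ℝ, 0 < c ∧ ∀ δ : ℝ, 0 < δ → δ < 1 → ∃ C : ℝ, 0 < C ∧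
      ∀ (X : Type u) [MeasurableSpace X] (H : Finset (X → Bool)),
        H.Nonempty → (∀ h ∈ H, Measurable h) →
      ∀ (k : ℕ), 1 ≤ k → ∀ ε : ℝ, 0 < ε → ε < 1 →
        (∃ π : Protocol X k, π.NoSharedRandomness ∧ AgnosticallyLearns π H c ε δ ∧
          ∀ ω,
            (π.exampleCost ω : ℝ) ≤ C * (k * lg H.card * lg (lg H.card) * lg (1 / ε)) ∧
            (π.bitCost ω : ℝ) ≤ C * (k * lg H.card * lg (lg H.card) * lg (1 / ε) ^ 2)) ∧
        (∃ π : Protocol X k, AgnosticallyLearns π H c ε δ ∧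
          ∀ ω,
            (π.exampleCost ω : ℝ) ≤ C * (k * lg H.card * lg (lg H.card) * lg (1 / ε)) ∧
            π.bitCost ω = 0) := by
  refine ⟨9, by norm_num, fun δ hδ hδ1 => ?_⟩
  -- Each block of `A` rounds multiplies the failure bound by `(5/6)^A < δ / 4`, which pays for a
  -- factor 2 of the class size; `K` blocks suffice.
  obtain ⟨A, hA⟩ := exists_pow_lt_of_lt_one (show (0 : ℝ) < δ / 4 by positivity)
    (show (5 / 6 : ℝ) < 1 by norm_num)
  -- The 8 is `2 * 4`, from `hKle` and `hble`.
  refine ⟨8 * (A + 1), by positivity, ?_⟩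
  intro X _ H hH hmeas k hk ε hε hε1
  have hL := one_le_lg (H.card : ℝ)
  have hLL := one_le_lg (lg (H.card : ℝ))
  have hE := one_le_lg (1 / ε)
  set K := ⌈lg (H.card : ℝ)⌉₊ with hK
  -- The additional digit brings the rounding error from `ε` down to `ε / 2`.
  set b := ⌈lg (1 / ε)⌉₊ + 1 with hb
  have hKpos : 1 ≤ K := Nat.one_le_ceil_iff.2 (zero_lt_one.trans_le hL)
  have hKle : (K : ℝ) ≤ 2 * lg (H.card : ℝ) := by
    linarith [(Nat.ceil_lt_add_one (zero_le_one.trans hL)).le]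
  have hble : (b : ℝ) + 1 ≤ 4 * lg (1 / ε) := by
    have := (Nat.ceil_lt_add_one (zero_le_one.trans hE)).le
    rw [hb]
    push_cast
    linarith
  have hcard : (H.card : ℝ) ≤ 2 ^ K := by
    refine (le_two_rpow_lg (by exact_mod_cast hH.card_pos)).trans ?_
    rw [← Real.rpow_natCast]
    exact Real.rpow_le_rpow_of_exponent_le one_le_two (Nat.le_ceil _)
  have hn : (H.card : ℝ) * (5 / 6 : ℝ) ^ (A * K) ≤ δ / 2 := by
    calc _ ≤ (2 : ℝ) ^ K * (5 / 6 : ℝ) ^ (A * K) := by gcongr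
      _ = (2 * (5 / 6 : ℝ) ^ A) ^ K := by rw [pow_mul, mul_pow]
      _ ≤ (2 * (5 / 6 : ℝ) ^ A) ^ 1 :=
        pow_le_pow_of_le_one (by positivity) (by linarith) hKpos
      _ ≤ δ / 2 := by linarith
  have hbε : (1 / 2 : ℝ) ^ b ≤ ε / 2 := by
    have h1 : 1 / ε ≤ 2 ^ ⌈lg (1 / ε)⌉₊ := by
      refine (le_two_rpow_lg (by positivity)).trans ?_
      rw [← Real.rpow_natCast]
      exact Real.rpow_le_rpow_of_exponent_le one_le_two (Nat.le_ceil _)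
    rw [hb, pow_succ, div_pow, one_pow]
    have h2 : 1 / (2 : ℝ) ^ ⌈lg (1 / ε)⌉₊ ≤ ε := by
      rw [div_le_iff₀ (by positivity)]
      rwa [div_le_iff₀' hε] at h1
    linarith
  obtain ⟨π, hp, hlearn, hcost⟩ := exists_protocol hH hmeas hk hε hδ hn hbε
  have hex : ∀ ω, (π.exampleCost ω : ℝ) ≤
      8 * (A + 1) * (k * lg H.card * lg (lg H.card) * lg (1 / ε)) := by
    intro ω
    rw [(hcost ω).1]
    push_cast
    calc (A : ℝ) * K * (k * (b + 1)) ≤ (A + 1) * (2 * lg H.card) * (k * (4 * lg (1 / ε))) := by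
          gcongr
          linarith
      _ = 8 * (A + 1) * (k * lg H.card * 1 * lg (1 / ε)) := by ring
      -- The double logarithm is pure slack: it is only used to be at least 1.
      _ ≤ _ := by gcongr
  refine ⟨⟨π, hp, hlearn, fun ω => ⟨hex ω, ?_⟩⟩, π, hlearn, fun ω => ⟨hex ω, (hcost ω).2⟩⟩
  rw [(hcost ω).2, Nat.cast_zero]
  positivity
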